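/- **Theorem.** A dueling-reward bandit instance with $K\ge 1$ arms consists of pairwise distinct reward means $\mu_k\in(0,1)$ and dueling probabilities $\nu_{k,\ell}\in(0,1)$ with $\nu_{k,\ell}=1-\nu_{\ell,k}$ and $\nu_{k,\ell}>\tfrac12$ whenever $\mu_k>\mu_\ell$. In each round $t$ the learner picks, possibly at random and depending on the past picks and observations (and possibly on the horizon $T$), an arm $k_t$ and a pair of arms $(k_{1,t},k_{2,t})$, and observes two independent samples: a Bernoulli reward with mean $\mu_{k_t}$, and the winner of the duel, which is $k_{1,t}$ with probability $\nu_{k_{1,t},k_{2,t}}$ and $k_{2,t}$ otherwise. Let $N_{k,T}$ be the number of rounds $t\le T$ with $k_t=k$, and let $M_{k,\ell,T}$ be the number of rounds $t\le T$ in which the dueled pair is $(k,\ell)$ or $(\ell,k)$. An algorithm is *consistent* if on every instance with $K$ arms (with the arms in any order), for every arm $k$ that does not have the largest reward mean and every $\gamma>0$, one has $\mathbb E[N_{k,T}]=o(T^\gamma)$ and $\mathbb E[M_{k,\ell,T}]=o(T^\gamma)$ for all $\ell\ne k$, as $T\to\infty$. Fix an instance with $\mu_1>\mu_2>\dots>\mu_K$.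 Put $\Delta^{R}_k=\mu_1-\mu_k$ and $\Delta^{D}_k=\nu_{1,k}-\tfrac12$, and for $\alpha\in[0,1]$ let $$R_T=\alpha\sum_{t=1}^T\Delta^{R}_{k_t}+(1-\alpha)\sum_{t=1}^T\frac{\Delta^{D}_{k_{1,t}}+\Delta^{D}_{k_{2,t}}}{2}.$$ Let $\mathrm{kl}(p,q)=p\log\frac pq+(1-p)\log\frac{1-p}{1-q}$. Then for every consistent algorithm $$\liminf_{T\to\infty}\frac{\mathbb E[R_T]}{\log T}\;\ge\;\sum_{k\ne1}\min\left\{\frac{\alpha\,\Delta^{R}_k}{\mathrm{kl}(\mu_k,\mu_1)},\ \min_{\ell<k}\frac{(1-\alpha)\,(\Delta^{D}_k+\Delta^{D}_\ell)}{2\,\mathrm{kl}(\nu_{k,\ell},\tfrac12)}\right\},$$ where the lower limit may be $+\infty$. -/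

import Mathlib

open Filter Finset

noncomputable section

namespace DRMAB

/-- Binary relative entropy: the Kullback--Leibler divergence between the Bernoulli
distributions with means `p` and `q`. -/
def kl (p q : ℝ) : ℝ :=
  p * Real.log (p / q) + (1 - p) * Real.log ((1 - p) / (1 - q))

/-- The Bernoulli distribution on `Bool` with mean `p`. -/
def bernoulli (p : ℝ) (hp : p ∈ Set.Ioo (0 : ℝ) 1) : PMF Bool :=
  PMF.ofFintype (fun b => ENNReal.ofReal (if b then p else 1 - p)) (by
    rw [Fintype.sum_bool, if_pos rfl, if_neg Bool.false_ne_true,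
      ← ENNReal.ofReal_add hp.1.le (sub_nonneg.2 hp.2.le)]
    simp)

/-- An instance of the dueling-reward bandit with `K` arms: the reward means `μ k` (pairwise
distinct, in any order) and the dueling probabilities `ν k l`, the probability that arm `k` beats
arm `l`. Apart from symmetry and `1/2 < ν k l` for `μ l < μ k`, they are unrelated.
(`ν k k = 1/2` follows from `ν_symm`.) -/
structure Model (K : ℕ) where
  μ : Fin K → ℝ
  ν : Fin K → Fin K → ℝ
  μ_mem : ∀ k, μ k ∈ Set.Ioo (0 : ℝ) 1
  ν_mem : ∀ k l, ν k l ∈ Set.Ioo (0 : ℝ) 1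
  μ_injective : Function.Injective μ
  ν_symm : ∀ k l, ν k l = 1 - ν l k
  ν_order : ∀ k l, μ l < μ k → 1 / 2 < ν k l

/-- The tuple picked in a round: the arm pulled for reward and the (ordered) pair that is dueled. -/
structure Action (K : ℕ) where
  arm : Fin K
  fst : Fin K
  snd : Fin K
  deriving DecidableEq, Fintype

/-- What is observed in a round: the Bernoulli reward, and the result of the duel
(`true`: the first arm of the pair wins; `false`: the second arm wins). -/
structure Feedback where
  reward : Bool
  fstWins : Bool
  deriving DecidableEq, Fintype

/-- The record of the first `t` rounds, in chronological order. -/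
abbrev History (K t : ℕ) : Type := Fin t → Action K × Feedback

/-- A (randomized) policy: the distribution of the next pick given the rounds played so far. -/
def Policy (K : ℕ) : Type := (t : ℕ) → History K t → PMF (Action K)

/-- An algorithm specifies the policy used when the horizon is `T`. Algorithms that do not know
the horizon are the constant families. -/
def Algorithm (K : ℕ) : Type := ℕ → Policy K

namespace Model

variable {K : ℕ}

/-- The law of the feedback for a given pick: the reward and the result of the duel are
independent Bernoulli variables with means `μ` of the arm and `ν` of the pair. -/
def feedback (I : Model K) (a : Action K) : PMF Feedback :=
  (bernoulli (I.μ a.arm) (I.μ_mem a.arm)).bind fun x =>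
    (bernoulli (I.ν a.fst a.snd) (I.ν_mem a.fst a.snd)).bind fun y =>
      PMF.pure ⟨x, y⟩

/-- The law of the first `t` rounds when policy `π` interacts with the instance `I`. -/
def law (I : Model K) (π : Policy K) : (t : ℕ) → PMF (History K t)
  | 0 => PMF.pure Fin.elim0
  | t + 1 => (law I π t).bind fun h => (π t h).bind fun a => (I.feedback a).bind fun y =>
      PMF.pure (Fin.snoc (α := fun _ => Action K × Feedback) h (a, y))

/-- Expectation of a function of the first `t` rounds (a finite sum). -/
def expect (I : Model K) (π : Policy K) (t : ℕ) (f : History K t → ℝ) : ℝ :=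
  ∑ h : History K t, (I.law π t h).toReal * f h

/-- Arm `k` is suboptimal: some arm has a larger reward mean. -/
def Suboptimal (I : Model K) (k : Fin K) : Prop := ∃ j, I.μ k < I.μ j

end Model

/-- `N_{k,t}`: the number of rounds in which arm `k` is picked for reward feedback. -/
def rewardCount {K t : ℕ} (k : Fin K) (h : History K t) : ℕ :=
  #{s : Fin t | (h s).1.arm = k}

/-- `M_{k,l,t}`: the number of rounds in which the pair `(k, l)` or `(l, k)` is dueled. -/
def duelCount {K t : ℕ} (k l : Fin K) (h : History K t) : ℕ :=
  #{s : Fin t | ((h s).1.fst = k ∧ (h s).1.snd = l) ∨ ((h s).1.fst = l ∧ (h s).1.snd = k)}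

/-- Consistency: on every instance, for every suboptimal arm `k` and every `γ > 0`,
`E[N_{k,T}] = o(T^γ)`, and `E[M_{k,l,T}] = o(T^γ)` for every arm `l ≠ k`. -/
def Algorithm.Consistent {K : ℕ} (π : Algorithm K) : Prop :=
  ∀ I : Model K, ∀ k : Fin K, I.Suboptimal k → ∀ γ : ℝ, 0 < γ →
    ((fun T : ℕ => I.expect (π T) T fun h => (rewardCount k h : ℝ))
      =o[atTop] fun T : ℕ => (T : ℝ) ^ γ) ∧
    ∀ l : Fin K, l ≠ k →
      ((fun T : ℕ => I.expect (π T) T fun h => (duelCount k l h : ℝ))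
        =o[atTop] fun T : ℕ => (T : ℝ) ^ γ)

namespace Model

/-! Gaps and regret, for an instance whose arms are labelled so that arm `0` is optimal. -/

variable {K : ℕ} [NeZero K]

/-- Reward gap of arm `k`. -/
def rewardGap (I : Model K) (k : Fin K) : ℝ := I.μ 0 - I.μ k

/-- Dueling gap of arm `k`. -/
def duelGap (I : Model K) (k : Fin K) : ℝ := I.ν 0 k - 1 / 2

/-- Reward-based regret. -/
def rewardRegret (I : Model K) {t : ℕ} (h : History K t) : ℝ :=
  ∑ s : Fin t, I.rewardGap (h s).1.arm

/-- Dueling-based regret: the sum of the averages of the dueling gaps of the two picked arms. -/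
def duelRegret (I : Model K) {t : ℕ} (h : History K t) : ℝ :=
  ∑ s : Fin t, (I.duelGap (h s).1.fst + I.duelGap (h s).1.snd) / 2

/-- The aggregated regret with weight `α`. -/
def regret (I : Model K) (α : ℝ) {t : ℕ} (h : History K t) : ℝ :=
  α * I.rewardRegret h + (1 - α) * I.duelRegret h

end Model

end DRMAB

end

/-! Change of measure, one suboptimal arm `k` at a time. In the instance `promote`, the mean of `k`
is raised just above the best one, and `k` beats each formerly better arm with probability just
above 1/2. Every other arm is then suboptimal, so by consistency the fraction of pulls of arms other
than `k` has expectation `o(T^(γ-1))` there, while in the original instance it tends to 1. By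
`mul_expect_le_divergence` the two history laws then have divergence at least about `log T`
(`eventually_mul_log_le_information`).

This divergence is paid for only by pulls of `k` and duels of `k` with better arms. The minimum in
the theorem bounds from below their regret per unit of divergence, in the limit as the promotion
shrinks (`eventually_mul_log_le_arm_regret`). Charging each duel to its worse arm makes the costs of
different `k` disjoint, so they add up (`sum_counts_le_regret`). -/

namespace DRMAB

/-! ### Bernoulli divergence and change of measure -/

theorem kl_one_sub (p q : ℝ) : kl (1 - p) (1 - q) = kl p q := by
  simp [kl, add_comm]

theorem kl_self (p : ℝ) : kl p p = 0 := by
  have h : ∀ x : ℝ, x * Real.log (x / x) = 0 := fun x => by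
    rcases eq_or_ne x 0 with rfl | hx
    · simp
    · simp [div_self hx]
  simp only [kl, h, add_zero]

theorem kl_nonneg {p q : ℝ} (hp : p ∈ Set.Ioo (0 : ℝ) 1) (hq : q ∈ Set.Ioo (0 : ℝ) 1) :
    0 ≤ kl p q := by
  have key : ∀ x y : ℝ, 0 < x → 0 < y → x - y ≤ x * Real.log (x / y) := fun x y hx hy => by
    have h := mul_le_mul_of_nonneg_left (Real.one_sub_inv_le_log_of_pos (div_pos hx hy)) hx.le
    have e : x * (1 - (x / y)⁻¹) = x - y := by field_simp
    rwa [e] at h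
  have h1 := key p q hp.1 hq.1
  have h2 := key (1 - p) (1 - q) (sub_pos.2 hp.2) (sub_pos.2 hq.2)
  unfold kl
  linarith

theorem continuousAt_kl_right {p q : ℝ} (hp : p ∈ Set.Ioo (0 : ℝ) 1)
    (hq : q ∈ Set.Ioo (0 : ℝ) 1) : ContinuousAt (kl p) q := by
  have h0 := hp.1.ne'
  have h1 := (sub_pos.2 hp.2).ne'
  have h2 := hq.1.ne'
  have h3 := (sub_pos.2 hq.2).ne'
  unfold kl
  exact ((continuousAt_const.div continuousAt_id h2).log (div_ne_zero h0 h2)).const_mul p |>.add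
    (((continuousAt_const.div (continuousAt_const.sub continuousAt_id) h3).log
      (div_ne_zero h1 h3)).const_mul (1 - p))

/-- Change of measure: if `p = q * exp L` and `p` sums to one, then `∑ p φ` exceeds
`∑ p L` by at most `log 2` as soon as `∑ q exp φ ≤ 2`. -/
theorem sum_mul_le_add_log_two {ι : Type*} [Fintype ι] {p q L φ : ι → ℝ} (hp0 : ∀ i, 0 ≤ p i)
    (hp : ∑ i, p i = 1) (hL : ∀ i, p i = q i * Real.exp (L i))
    (hφ : ∑ i, q i * Real.exp (φ i) ≤ 2) :
    ∑ i, p i * φ i ≤ ∑ i, p i * L i + Real.log 2 := by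
  -- This is `x + 1 ≤ exp x` at `x = φ - L - log 2`, weighted by `p`; the factor `exp (-L)` turns
  -- `p` into `q`.
  have key : ∀ i, p i * (φ i - L i - Real.log 2) ≤ q i * Real.exp (φ i) / 2 - p i := fun i => by
    have h := mul_le_mul_of_nonneg_left
      (Real.add_one_le_exp (φ i - L i - Real.log 2)) (hp0 i)
    have e : p i * Real.exp (φ i - L i - Real.log 2) = q i * Real.exp (φ i) / 2 := by
      rw [Real.exp_sub, Real.exp_sub, Real.exp_log two_pos, hL i]
      field_simp
    rw [e] at h
    linarith
  have h := Finset.sum_le_sum fun i (_ : i ∈ univ) => key i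
  simp only [mul_sub, Finset.sum_sub_distrib, ← Finset.sum_mul, ← Finset.sum_div, hp] at h
  linarith

/-! ### The law of histories and its expectations -/

namespace Model

variable {K : ℕ}

/-- The probability of the feedback `y` for the pick `a`, as a real number. -/
def feedbackProb (I : Model K) (a : Action K) (y : Feedback) : ℝ :=
  (if y.reward then I.μ a.arm else 1 - I.μ a.arm) *
    (if y.fstWins then I.ν a.fst a.snd else 1 - I.ν a.fst a.snd)

theorem feedbackProb_pos (I : Model K) (a : Action K) (y : Feedback) : 0 < I.feedbackProb a y := by
  have h1 := I.μ_mem a.arm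
  have h2 := I.ν_mem a.fst a.snd
  unfold feedbackProb
  refine mul_pos ?_ ?_ <;> split_ifs <;> simp_all

theorem toReal_bernoulli (p : ℝ) (hp : p ∈ Set.Ioo (0 : ℝ) 1) (b : Bool) :
    (bernoulli p hp b).toReal = if b then p else 1 - p := by
  have : (0 : ℝ) ≤ if b then p else 1 - p := by
    split_ifs
    exacts [hp.1.le, (sub_pos.2 hp.2).le]
  simp [bernoulli, PMF.ofFintype_apply, ENNReal.toReal_ofReal this]

theorem toReal_feedback (I : Model K) (a : Action K) (y : Feedback) :
    (I.feedback a y).toReal = I.feedbackProb a y := by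
  obtain ⟨x, z⟩ := y
  have : I.feedback a ⟨x, z⟩ = bernoulli (I.μ a.arm) (I.μ_mem a.arm) x *
      bernoulli (I.ν a.fst a.snd) (I.ν_mem a.fst a.snd) z := by
    cases x <;> cases z <;> simp [feedback, PMF.bind_apply, tsum_fintype, PMF.pure_apply]
  rw [this, ENNReal.toReal_mul, toReal_bernoulli, toReal_bernoulli]
  rfl

theorem sum_feedback (F : Feedback → ℝ) :
    ∑ y, F y = F ⟨true, true⟩ + F ⟨true, false⟩ + F ⟨false, true⟩ + F ⟨false, false⟩ := by
  let e : Bool × Bool ≃ Feedback :=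
    ⟨fun b => ⟨b.1, b.2⟩, fun y => (y.1, y.2), fun _ => rfl, fun _ => rfl⟩
  rw [← e.sum_comp, Fintype.sum_prod_type]
  simp [e, add_assoc]

theorem sum_feedbackProb (I : Model K) (a : Action K) : ∑ y, I.feedbackProb a y = 1 := by
  rw [sum_feedback]
  simp only [feedbackProb, if_true, Bool.false_eq_true, if_false]
  ring

theorem sum_history_succ {t : ℕ} (F : History K (t + 1) → ℝ) :
    ∑ h, F h = ∑ h : History K t, ∑ a, ∑ y,
      F (Fin.snoc (α := fun _ => Action K × Feedback) h (a, y)) := by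
  rw [← (Fin.snocEquiv fun _ : Fin (t + 1) => Action K × Feedback).sum_comp,
    Fintype.sum_prod_type, Finset.sum_comm]
  refine Finset.sum_congr rfl fun h _ => ?_
  rw [Fintype.sum_prod_type]
  rfl

theorem toReal_law_snoc (I : Model K) (π : Policy K) {t : ℕ} (h : History K t) (a : Action K)
    (y : Feedback) :
    (I.law π (t + 1) (Fin.snoc (α := fun _ => Action K × Feedback) h (a, y))).toReal =
      (I.law π t h).toReal * ((π t h a).toReal * I.feedbackProb a y) := by
  rw [← toReal_feedback, ← ENNReal.toReal_mul, ← ENNReal.toReal_mul]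
  congr 1
  simp only [law, PMF.bind_apply, PMF.pure_apply, tsum_fintype, Fin.snoc_inj, Prod.mk.injEq,
    mul_ite, mul_one, mul_zero]
  rw [Finset.sum_eq_single h, Finset.sum_eq_single a, Finset.sum_eq_single y] <;>
    simp +contextual [eq_comm]

theorem sum_toReal_pmf {β : Type*} [Fintype β] (p : PMF β) : ∑ b, (p b).toReal = 1 := by
  rw [← ENNReal.toReal_sum fun b _ => p.apply_ne_top b,
    ← tsum_fintype (L := .unconditional β), p.tsum_coe, ENNReal.toReal_one]

theorem expect_succ (I : Model K) (π : Policy K) (t : ℕ) (F : History K (t + 1) → ℝ) :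
    I.expect π (t + 1) F = I.expect π t fun h => ∑ a, (π t h a).toReal *
      ∑ y, I.feedbackProb a y * F (Fin.snoc (α := fun _ => Action K × Feedback) h (a, y)) := by
  simp only [expect, sum_history_succ, toReal_law_snoc, Finset.mul_sum, mul_assoc]

theorem expect_mono (I : Model K) (π : Policy K) {t : ℕ} {F G : History K t → ℝ}
    (h : ∀ x, F x ≤ G x) : I.expect π t F ≤ I.expect π t G :=
  Finset.sum_le_sum fun x _ => mul_le_mul_of_nonneg_left (h x) ENNReal.toReal_nonneg

theorem expect_add (I : Model K) (π : Policy K) {t : ℕ} (F G : History K t → ℝ) :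
    I.expect π t (fun h => F h + G h) = I.expect π t F + I.expect π t G := by
  simp only [expect, mul_add, Finset.sum_add_distrib]

theorem expect_const_mul (I : Model K) (π : Policy K) {t : ℕ} (c : ℝ) (F : History K t → ℝ) :
    I.expect π t (fun h => c * F h) = c * I.expect π t F := by
  simp only [expect, Finset.mul_sum, mul_left_comm]

theorem expect_sum (I : Model K) (π : Policy K) {t : ℕ} {β : Type*} (s : Finset β)
    (F : β → History K t → ℝ) :
    I.expect π t (fun h => ∑ b ∈ s, F b h) = ∑ b ∈ s, I.expect π t (F b) := by
  simp only [expect, Finset.mul_sum]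
  exact Finset.sum_comm

theorem expect_const (I : Model K) (π : Policy K) (t : ℕ) (c : ℝ) :
    I.expect π t (fun _ => c) = c := by
  rw [expect, ← Finset.sum_mul, sum_toReal_pmf, one_mul]

theorem expect_nonneg (I : Model K) (π : Policy K) {t : ℕ} {F : History K t → ℝ}
    (h : ∀ x, 0 ≤ F x) : 0 ≤ I.expect π t F :=
  Finset.sum_nonneg fun x _ => mul_nonneg ENNReal.toReal_nonneg (h x)

/-! ### Likelihood ratios and divergence of history laws -/

/-- The log-likelihood ratio of a single feedback. -/
noncomputable def logRatio (I J : Model K) (z : Action K × Feedback) : ℝ :=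
  Real.log (I.feedbackProb z.1 z.2 / J.feedbackProb z.1 z.2)

theorem sum_snoc {t : ℕ} (g : Action K × Feedback → ℝ) (h : History K t)
    (z : Action K × Feedback) :
    ∑ s, g ((Fin.snoc (α := fun _ => Action K × Feedback) h z : History K (t + 1)) s) =
      ∑ s, g (h s) + g z := by
  rw [Fin.sum_univ_castSucc]
  simp

/-- The policy factors are common to both laws, so only feedback factors remain; these are positive,
so histories of probability zero need no exception. -/
theorem toReal_law_eq_mul_exp (I J : Model K) (π : Policy K) (t : ℕ) (h : History K t) :
    (I.law π t h).toReal = (J.law π t h).toReal * Real.exp (∑ s, I.logRatio J (h s)) := by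
  induction t with
  | zero => simp [law]
  | succ t ih =>
    obtain ⟨⟨⟨a, y⟩, h⟩, rfl⟩ :=
      (Fin.snocEquiv fun _ : Fin (t + 1) => Action K × Feedback).surjective h
    change (I.law π (t + 1) (Fin.snoc (α := fun _ => Action K × Feedback) h (a, y))).toReal =
      (J.law π (t + 1) (Fin.snoc (α := fun _ => Action K × Feedback) h (a, y))).toReal *
      Real.exp (∑ s, I.logRatio J
        ((Fin.snoc (α := fun _ => Action K × Feedback) h (a, y) : History K (t + 1)) s))
    rw [sum_snoc, toReal_law_snoc, toReal_law_snoc, ih h, Real.exp_add, logRatio,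
      Real.exp_log (div_pos (I.feedbackProb_pos a y) (J.feedbackProb_pos a y))]
    have := (J.feedbackProb_pos a y).ne'
    field_simp

/-- Tower property: given the past and the pick, each feedback may be averaged out. -/
theorem expect_sum_feedback (I : Model K) (π : Policy K) (t : ℕ)
    (g : Action K × Feedback → ℝ) :
    I.expect π t (fun h => ∑ s, g (h s)) =
      I.expect π t fun h => ∑ s, ∑ y, I.feedbackProb (h s).1 y * g ((h s).1, y) := by
  induction t with
  | zero => simp
  | succ t ih =>
    have key : ∀ g : Action K × Feedback → ℝ, I.expect π (t + 1) (fun h => ∑ s, g (h s)) =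
        I.expect π t (fun h => ∑ s, g (h s)) + I.expect π t fun h => ∑ a, (π t h a).toReal *
          ∑ y, I.feedbackProb a y * g (a, y) := fun g => by
      rw [expect_succ, ← expect_add]
      congr 1
      funext h
      simp only [sum_snoc, mul_add, Finset.sum_add_distrib, ← Finset.sum_mul, sum_feedbackProb,
        one_mul, sum_toReal_pmf]
    rw [key, ih, key fun z => ∑ y, I.feedbackProb z.1 y * g (z.1, y)]
    simp only [← Finset.sum_mul, sum_feedbackProb, one_mul]

/-- Reward and duel are independent, so their divergences add. -/
theorem sum_feedbackProb_mul_logRatio (I J : Model K) (a : Action K) :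
    ∑ y, I.feedbackProb a y * I.logRatio J (a, y) =
      kl (I.μ a.arm) (J.μ a.arm) + kl (I.ν a.fst a.snd) (J.ν a.fst a.snd) := by
  obtain ⟨h1, h2⟩ := I.μ_mem a.arm
  obtain ⟨h3, h4⟩ := I.ν_mem a.fst a.snd
  obtain ⟨h5, h6⟩ := J.μ_mem a.arm
  obtain ⟨h7, h8⟩ := J.ν_mem a.fst a.snd
  have key : ∀ x y z w : ℝ, 0 < x → 0 < y → 0 < z → 0 < w →
      Real.log (x * y / (z * w)) = Real.log (x / z) + Real.log (y / w) := fun x y z w _ _ _ _ => by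
    rw [mul_div_mul_comm, Real.log_mul] <;> positivity
  rw [← sub_pos] at h2 h4 h6 h8
  rw [sum_feedback]
  simp only [feedbackProb, logRatio, if_true, Bool.false_eq_true, if_false]
  rw [key, key, key, key] <;> try assumption
  unfold kl
  ring

/-- Lower bound on the divergence between two instances, in terms of a `[0, 1]`-valued
statistic. -/
theorem mul_expect_le_divergence (I J : Model K) (π : Policy K) (t : ℕ) (W : History K t → ℝ)
    (hW : ∀ h, W h ∈ Set.Icc (0 : ℝ) 1) (c : ℝ)
    (hc : Real.exp c * J.expect π t W ≤ 1) :
    c * I.expect π t W ≤ I.expect π t (fun h => ∑ s, (kl (I.μ (h s).1.arm) (J.μ (h s).1.arm) +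
      kl (I.ν (h s).1.fst (h s).1.snd) (J.ν (h s).1.fst (h s).1.snd))) + Real.log 2 := by
  simp only [← sum_feedbackProb_mul_logRatio]
  rw [← expect_sum_feedback, ← expect_const_mul]
  refine sum_mul_le_add_log_two (fun _ => ENNReal.toReal_nonneg) (sum_toReal_pmf _)
    (I.toReal_law_eq_mul_exp J π t) ?_
  calc J.expect π t (fun h => Real.exp (c * W h))
      -- Convexity of `exp` between 0 and `c` gives `exp (c W) ≤ (1 - W) + W exp c`.
      ≤ J.expect π t (fun h => 1 + Real.exp c * W h) := J.expect_mono π fun x => by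
        have h := convexOn_exp.2 (Set.mem_univ 0) (Set.mem_univ c) (sub_nonneg.2 (hW x).2) (hW x).1
          (sub_add_cancel _ _)
        simp only [smul_eq_mul, mul_zero, zero_add, Real.exp_zero, mul_one] at h
        rw [mul_comm c, mul_comm (Real.exp c)]
        linarith [(hW x).1]
    _ = 1 + Real.exp c * J.expect π t W := by rw [expect_add, expect_const, expect_const_mul]
    _ ≤ 2 := by linarith

end Model

theorem rewardCount_eq_sum {K t : ℕ} (k : Fin K) (h : History K t) :
    (rewardCount k h : ℝ) = ∑ s, if (h s).1.arm = k then 1 else 0 := by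
  rw [rewardCount, Finset.sum_boole]

theorem duelCount_eq_sum {K t : ℕ} (k l : Fin K) (h : History K t) :
    (duelCount k l h : ℝ) = ∑ s, if ((h s).1.fst = k ∧ (h s).1.snd = l) ∨
      ((h s).1.fst = l ∧ (h s).1.snd = k) then 1 else 0 := by
  rw [duelCount, Finset.sum_boole]

theorem sum_rewardCount {K t : ℕ} (h : History K t) : ∑ k, (rewardCount k h : ℝ) = t := by
  simp only [rewardCount_eq_sum]
  rw [Finset.sum_comm]
  simp

/-! ### The promoted instance -/

namespace Model

variable {K : ℕ}

/-- The instance in which arm `k` becomes optimal: its mean is raised to `m`, and it beats every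
arm that used to be better with probability `v`. -/
noncomputable def promote (I : Model K) (k : Fin K) (m v : ℝ) (hm : m ∈ Set.Ioo (0 : ℝ) 1)
    (hv : v ∈ Set.Ioo (1 / 2 : ℝ) 1) (hmax : ∀ j, I.μ j < m) : Model K where
  μ := Function.update I.μ k m
  ν i j := if i = k ∧ I.μ k < I.μ j then v else if j = k ∧ I.μ k < I.μ i then 1 - v else I.ν i j
  μ_mem i := by
    rcases eq_or_ne i k with rfl | h
    · simpa using hm
    · simpa [h] using I.μ_mem i
  ν_mem i j := by
    have := I.ν_mem i j
    obtain ⟨h1, h2⟩ := hv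
    split_ifs
    · exact ⟨by linarith, h2⟩
    · constructor <;> linarith
    · exact this
  μ_injective i j h := by
    by_cases hi : i = k <;> by_cases hj : j = k
    · rw [hi, hj]
    · simp only [hi, Function.update_self, Function.update_of_ne hj] at h
      exact absurd h (hmax j).ne'
    · simp only [hj, Function.update_self, Function.update_of_ne hi] at h
      exact absurd h (hmax i).ne
    · simp only [Function.update_of_ne hj, Function.update_of_ne hi] at h
      exact I.μ_injective h
  ν_symm i j := by
    have := I.ν_symm i j
    by_cases h1 : i = k ∧ I.μ k < I.μ j <;> by_cases h2 : j = k ∧ I.μ k < I.μ i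
    · exact absurd h1.2 (by rw [h2.1]; exact lt_irrefl _)
    · rw [if_pos h1, if_neg h2, if_pos h1]
      ring
    · rw [if_neg h1, if_pos h2, if_pos h2]
    · rwa [if_neg h1, if_neg h2, if_neg h1, if_neg h2]
  ν_order i j h := by
    by_cases hi : i = k <;> by_cases hj : j = k
    · rw [hi, hj] at h
      exact absurd h (lt_irrefl _)
    · by_cases hkj : I.μ k < I.μ j
      · simpa [hi, hkj] using hv.1
      -- Arms that were already worse than `k` keep their duel probabilities, which have the right
      -- sign.
      · have : I.μ j < I.μ k := lt_of_le_of_ne (not_lt.1 hkj) fun e => hj (I.μ_injective e)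
        simpa [hi, hj, hkj] using I.ν_order k j this
    · simp only [hj, Function.update_self, Function.update_of_ne hi] at h
      exact absurd (hmax i) h.not_gt
    · simp only [Function.update_of_ne hj, Function.update_of_ne hi] at h
      simpa [hi, hj] using I.ν_order i j h

section promote

variable (I : Model K) (k : Fin K) (m v : ℝ) (hm : m ∈ Set.Ioo (0 : ℝ) 1)
    (hv : v ∈ Set.Ioo (1 / 2 : ℝ) 1) (hmax : ∀ j, I.μ j < m)

theorem suboptimal_promote {j : Fin K} (hj : j ≠ k) :
    (I.promote k m v hm hv hmax).Suboptimal j :=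
  ⟨k, by simpa [promote, hj] using hmax j⟩

theorem kl_promote_mean (i : Fin K) :
    kl (I.μ i) ((I.promote k m v hm hv hmax).μ i) = if i = k then kl (I.μ k) m else 0 := by
  rcases eq_or_ne i k with rfl | h
  · simp [promote]
  · simp [promote, h, kl_self]

theorem kl_promote_duel (i j : Fin K) :
    kl (I.ν i j) ((I.promote k m v hm hv hmax).ν i j) ≤
      ∑ l with I.μ k < I.μ l,
        if (i = k ∧ j = l) ∨ (i = l ∧ j = k) then kl (I.ν k l) v else 0 := by
  have hv' : v ∈ Set.Ioo (0 : ℝ) 1 := ⟨by linarith [hv.1], hv.2⟩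
  have h0 : ∀ l, 0 ≤ if (i = k ∧ j = l) ∨ (i = l ∧ j = k) then kl (I.ν k l) v else 0 := fun l => by
    split_ifs
    exacts [kl_nonneg (I.ν_mem k l) hv', le_rfl]
  have hle : ∀ l, I.μ k < I.μ l → ((i = k ∧ j = l) ∨ (i = l ∧ j = k)) → kl (I.ν k l) v ≤
      ∑ l with I.μ k < I.μ l,
        if (i = k ∧ j = l) ∨ (i = l ∧ j = k) then kl (I.ν k l) v else 0 := fun l hl h => by
    have := Finset.single_le_sum (s := {l | I.μ k < I.μ l}) (fun l _ => h0 l)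
      (Finset.mem_filter.2 ⟨Finset.mem_univ l, hl⟩)
    rwa [if_pos h] at this
  simp only [promote]
  split_ifs with h1 h2
  · obtain ⟨rfl, h⟩ := h1
    exact hle j h (Or.inl ⟨rfl, rfl⟩)
  · obtain ⟨rfl, h⟩ := h2
    rw [I.ν_symm i j, kl_one_sub]
    exact hle i h (Or.inr ⟨rfl, rfl⟩)
  · rw [kl_self]
    exact Finset.sum_nonneg fun l _ => h0 l

/-- Only pulls of `k` and duels of `k` with a formerly better arm have different laws in the two
instances. -/
theorem divergence_promote_le (π : Policy K) (t : ℕ) :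
    I.expect π t (fun h => ∑ s,
      (kl (I.μ (h s).1.arm) ((I.promote k m v hm hv hmax).μ (h s).1.arm) +
        kl (I.ν (h s).1.fst (h s).1.snd)
          ((I.promote k m v hm hv hmax).ν (h s).1.fst (h s).1.snd))) ≤
      kl (I.μ k) m * I.expect π t (fun h => (rewardCount k h : ℝ)) +
        ∑ l with I.μ k < I.μ l,
          kl (I.ν k l) v * I.expect π t (fun h => (duelCount k l h : ℝ)) := by
  simp only [← expect_const_mul]
  rw [← expect_sum, ← expect_add]
  refine I.expect_mono π fun h => ?_
  rw [Finset.sum_add_distrib]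
  refine add_le_add (le_of_eq ?_) ?_
  · rw [rewardCount_eq_sum, Finset.mul_sum]
    simp only [kl_promote_mean, mul_ite, mul_one, mul_zero]
  · simp only [duelCount_eq_sum, Finset.mul_sum, mul_ite, mul_one, mul_zero]
    rw [Finset.sum_comm]
    exact Finset.sum_le_sum fun s _ => I.kl_promote_duel k m v hm hv hmax _ _

end promote

/-! ### The information lower bound -/

/-- Asymptotically, a consistent algorithm gathers information of at least `log T` against each
instance in which a suboptimal arm is promoted. -/
theorem eventually_mul_log_le_information (I : Model K) {k : Fin K} {m v : ℝ}
    (hm : m ∈ Set.Ioo (0 : ℝ) 1) (hv : v ∈ Set.Ioo (1 / 2 : ℝ) 1) (hmax : ∀ j, I.μ j < m)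
    {π : Algorithm K} (hπ : π.Consistent) (hk : I.Suboptimal k) {c : ℝ} (hc : c < 1) :
    ∀ᶠ T : ℕ in atTop, c * Real.log T ≤
      kl (I.μ k) m * I.expect (π T) T (fun h => (rewardCount k h : ℝ)) +
        ∑ l with I.μ k < I.μ l,
          kl (I.ν k l) v * I.expect (π T) T (fun h => (duelCount k l h : ℝ)) := by
  set J := I.promote k m v hm hv hmax
  -- With this choice `1 - γ = (1 + c) / 2 > c`, which leaves room for the error terms.
  let γ : ℝ := (1 - c) / 2
  have hγ : 0 < γ := by simp only [γ]; linarith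
  -- The distinguishing statistic: the fraction of reward pulls spent on arms other than `k`.
  let W : (T : ℕ) → History K T → ℝ := fun T h => ∑ j with j ≠ k, (rewardCount j h : ℝ) / T
  have hW : ∀ T (h : History K T), 0 < T → W T h = 1 - rewardCount k h / T := fun T h hT => by
    have h1 := sum_rewardCount h
    rw [← Finset.add_sum_erase _ _ (Finset.mem_univ k), ← Finset.filter_ne'] at h1
    have hT' : (T : ℝ) ≠ 0 := by positivity
    rw [eq_sub_iff_add_eq]
    simp only [W, ← Finset.sum_div, ← add_div]
    rw [add_comm, h1, div_self hT']
  have hJ : Tendsto (fun T : ℕ => (∑ j with j ≠ k,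
      J.expect (π T) T fun h => (rewardCount j h : ℝ)) / (T : ℝ) ^ γ) atTop (nhds 0) := by
    refine (Asymptotics.IsLittleO.fun_sum fun j hj => ?_).tendsto_div_nhds_zero
    exact (hπ J j (I.suboptimal_promote k m v hm hv hmax (Finset.mem_filter.1 hj).2) γ hγ).1
  have hI : Tendsto (fun T : ℕ => (I.expect (π T) T fun h => (rewardCount k h : ℝ)) /
      (T : ℝ) ^ (1 : ℝ)) atTop (nhds 0) := ((hπ I k hk 1 one_pos).1).tendsto_div_nhds_zero
  have hlog : Tendsto (fun T : ℕ => Real.log (T : ℝ)) atTop atTop :=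
    Real.tendsto_log_atTop.comp tendsto_natCast_atTop_atTop
  have hlim : Tendsto (fun T : ℕ => (1 - γ) * (1 - (I.expect (π T) T fun h =>
      (rewardCount k h : ℝ)) / (T : ℝ) ^ (1 : ℝ)) - Real.log 2 / Real.log T) atTop
      (nhds ((1 - γ) * (1 - 0) - 0)) :=
    ((tendsto_const_nhds.sub hI).const_mul _).sub (hlog.const_div_atTop _)
  have hcγ : c < (1 - γ) * (1 - 0) - 0 := by simp only [γ]; linarith
  filter_upwards [hJ.eventually_lt_const one_pos, hlim.eventually_const_lt hcγ,
    hlog.eventually_gt_atTop 0, eventually_gt_atTop 0] with T h1 h2 h3 h4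
  have hT : (0 : ℝ) < T := by positivity
  rw [Real.rpow_one] at h2
  have hEW : I.expect (π T) T (W T) =
      1 - (I.expect (π T) T fun h => (rewardCount k h : ℝ)) / T := by
    have := I.expect_add (π T) (W T) fun h => (T : ℝ)⁻¹ * rewardCount k h
    rw [expect_const_mul] at this
    rw [eq_sub_iff_add_eq, div_eq_inv_mul, ← this, ← I.expect_const (π T) T 1]
    congr 1
    funext h
    rw [hW T h h4, div_eq_inv_mul, sub_add_cancel]
  have h5 := I.mul_expect_le_divergence J (π T) T (W T) (fun h => ⟨?_, ?_⟩)
    ((1 - γ) * Real.log T) ?_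
  · refine le_trans ?_ (I.divergence_promote_le k m v hm hv hmax (π T) T)
    rw [hEW] at h5
    have h6 := mul_le_mul_of_nonneg_right h2.le h3.le
    rw [sub_mul, div_mul_cancel₀ _ h3.ne'] at h6
    linarith
  · exact Finset.sum_nonneg fun j _ => by positivity
  · rw [hW T h h4]
    have : (0 : ℝ) ≤ rewardCount k h / T := by positivity
    linarith
  · have : J.expect (π T) T (W T) =
        (∑ j with j ≠ k, J.expect (π T) T fun h => (rewardCount j h : ℝ)) / T := by
      simp only [W, div_eq_inv_mul]
      rw [expect_sum, Finset.mul_sum]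
      simp only [expect_const_mul]
    -- `exp ((1 - γ) log T) = T / T ^ γ`; the factor `T` cancels the normalization of `W`, leaving
    -- the quotient in `hJ`.
    rw [this, mul_comm (1 - γ), ← Real.rpow_def_of_pos hT, Real.rpow_sub hT, Real.rpow_one]
    have h6 : (0 : ℝ) < (T : ℝ) ^ γ := Real.rpow_pos_of_pos hT _
    calc _ = _ := by field_simp
      _ ≤ 1 := h1.le

/-! ### From information to regret -/

theorem ν_self (I : Model K) (k : Fin K) : I.ν k k = 1 / 2 := by
  linarith [I.ν_symm k k]

variable [NeZero K]

theorem duelGap_nonneg (I : Model K) (hI : StrictAnti I.μ) (k : Fin K) : 0 ≤ I.duelGap k := by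
  rcases eq_or_ne k 0 with rfl | hk
  · simp [duelGap, ν_self]
  · exact sub_nonneg.2 (I.ν_order 0 k (hI (Fin.pos_iff_ne_zero.2 hk))).le

/-- The regret is at least the sum over the suboptimal arms `k` of the regret incurred by pulling
`k` and by dueling `k` with a better arm. -/
theorem sum_counts_le_regret (I : Model K) (hI : StrictAnti I.μ) {α : ℝ}
    (hα : α ∈ Set.Icc (0 : ℝ) 1) {t : ℕ} (h : History K t) :
    ∑ k with k ≠ 0, (α * I.rewardGap k * rewardCount k h +
      ∑ l with l < k, (1 - α) * ((I.duelGap k + I.duelGap l) / 2) * duelCount k l h) ≤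
      I.regret α h := by
  have h1 : ∑ k with k ≠ 0, I.rewardGap k * rewardCount k h = I.rewardRegret h := by
    have h0 : I.rewardGap 0 = 0 := sub_self _
    have : ∑ k with k ≠ 0, I.rewardGap k * rewardCount k h =
        ∑ k, I.rewardGap k * rewardCount k h :=
      Finset.sum_filter_of_ne fun k _ hk h' => hk (by rw [h', h0, zero_mul])
    rw [this]
    simp only [rewardCount_eq_sum, Finset.mul_sum]
    rw [Finset.sum_comm]
    simp [rewardRegret]
  -- A duel of two distinct arms occurs in exactly one term, with `k` the worse arm; a duel of an
  -- arm with itself occurs in none.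
  have key : ∀ i j : Fin K, ∑ k with k ≠ 0, ∑ l with l < k,
      (I.duelGap k + I.duelGap l) / 2 * (if (i = k ∧ j = l) ∨ (i = l ∧ j = k) then 1 else 0) ≤
      (I.duelGap i + I.duelGap j) / 2 := fun i j => by
    have h0 : ∀ k l, 0 ≤ (I.duelGap k + I.duelGap l) / 2 := fun k l => by
      linarith [I.duelGap_nonneg hI k, I.duelGap_nonneg hI l]
    calc _ ≤ ∑ k, ∑ l with l < k, (I.duelGap k + I.duelGap l) / 2 *
          (if (i = k ∧ j = l) ∨ (i = l ∧ j = k) then 1 else 0) :=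
          Finset.sum_le_sum_of_subset_of_nonneg (Finset.filter_subset _ _) fun k _ _ =>
            Finset.sum_nonneg fun l _ => mul_nonneg (h0 k l) (by split_ifs <;> norm_num)
      _ ≤ ∑ k, ∑ l, ((if i = k then if j = l then
              if l < k then (I.duelGap k + I.duelGap l) / 2 else 0 else 0 else 0) +
            if j = k then if i = l then
              if l < k then (I.duelGap k + I.duelGap l) / 2 else 0 else 0 else 0) := by
          refine Finset.sum_le_sum fun k _ => ?_
          rw [Finset.sum_filter]
          refine Finset.sum_le_sum fun l _ => ?_
          have := h0 k l
          split_ifs <;> simp_all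
      _ = (if j < i then (I.duelGap i + I.duelGap j) / 2 else 0) +
            if i < j then (I.duelGap j + I.duelGap i) / 2 else 0 := by
          simp [Finset.sum_add_distrib]
      _ ≤ _ := by
          have := h0 i j
          rcases lt_trichotomy i j with hij | rfl | hij
          · simp [hij, hij.not_gt, add_comm]
          · simpa using this
          · simp [hij, hij.not_gt]
  have h2 : ∑ k with k ≠ 0, ∑ l with l < k,
      (I.duelGap k + I.duelGap l) / 2 * duelCount k l h ≤ I.duelRegret h := by
    simp only [duelCount_eq_sum, Finset.mul_sum]
    rw [Finset.sum_congr rfl fun k _ => Finset.sum_comm, Finset.sum_comm]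
    exact Finset.sum_le_sum fun s _ => key _ _
  rw [regret, ← h1, Finset.sum_add_distrib]
  simp only [mul_assoc, ← Finset.mul_sum]
  have := mul_le_mul_of_nonneg_left h2 (sub_nonneg.2 hα.2)
  linarith

/-- Asymptotic lower bound on the regret due to a single suboptimal arm. -/
theorem eventually_mul_log_le_arm_regret (I : Model K) (hI : StrictAnti I.μ) {π : Algorithm K}
    (hπ : π.Consistent) {α : ℝ} (hα : α ∈ Set.Icc (0 : ℝ) 1) {k : Fin K} (hk : k ≠ 0) {c : ℝ}
    (hc : c < min (α * I.rewardGap k / kl (I.μ k) (I.μ 0)) (⨅ l : Set.Iio k,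
      (1 - α) * (I.duelGap k + I.duelGap l) / (2 * kl (I.ν k l) (1 / 2)))) :
    ∀ᶠ T : ℕ in atTop, c * Real.log T ≤
      α * I.rewardGap k * I.expect (π T) T (fun h => (rewardCount k h : ℝ)) +
        ∑ l with l < k, (1 - α) * ((I.duelGap k + I.duelGap l) / 2) *
          I.expect (π T) T (fun h => (duelCount k l h : ℝ)) := by
  have hk0 : I.μ k < I.μ 0 := hI (Fin.pos_iff_ne_zero.2 hk)
  have hN : ∀ T, 0 ≤ I.expect (π T) T (fun h => (rewardCount k h : ℝ)) := fun T =>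
    I.expect_nonneg _ fun h => Nat.cast_nonneg _
  have hM : ∀ l T, 0 ≤ I.expect (π T) T (fun h => (duelCount k l h : ℝ)) := fun l T =>
    I.expect_nonneg _ fun h => Nat.cast_nonneg _
  have hlog : Tendsto (fun T : ℕ => Real.log (T : ℝ)) atTop atTop :=
    Real.tendsto_log_atTop.comp tendsto_natCast_atTop_atTop
  rcases le_or_gt c 0 with hc0 | hc0
  · filter_upwards [hlog.eventually_ge_atTop 0] with T hT
    refine (mul_nonpos_of_nonpos_of_nonneg hc0 hT).trans (add_nonneg ?_ ?_)
    · exact mul_nonneg (mul_nonneg hα.1 (sub_nonneg.2 hk0.le)) (hN T)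
    · refine Finset.sum_nonneg fun l _ => mul_nonneg (mul_nonneg (sub_nonneg.2 hα.2) ?_) (hM l T)
      linarith [I.duelGap_nonneg hI k, I.duelGap_nonneg hI l]
  -- The gap between `c` and the minimum is used twice: `c / d < 1` feeds the information bound, and
  -- the strict bounds for `d` survive a small promotion.
  obtain ⟨d, hcd, hd⟩ := exists_between hc
  have hd0 := hc0.trans hcd
  have half_mem : (1 / 2 : ℝ) ∈ Set.Ioo (0 : ℝ) 1 := by norm_num
  -- A vanishing divergence would make the quotient 0 by convention, contradicting `0 < d`; so
  -- positivity of `kl` is not needed.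
  have mul_lt : ∀ x y : ℝ, 0 ≤ y → d < x / y → d * y < x := fun x y hy h => by
    rcases hy.eq_or_lt with rfl | hy
    · simp only [div_zero] at h
      exact absurd h hd0.not_gt
    · exact (lt_div_iff₀ hy).1 h
  have hA := mul_lt _ _ (kl_nonneg (I.μ_mem k) (I.μ_mem 0)) (lt_min_iff.1 hd).1
  have hB : ∀ l, l < k →
      d * kl (I.ν k l) (1 / 2) < (1 - α) * ((I.duelGap k + I.duelGap l) / 2) := fun l hl => by
    have h1 := (lt_min_iff.1 hd).2.trans_le
      (ciInf_le (Set.finite_range _).bddBelow (⟨l, hl⟩ : Set.Iio k))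
    have h2 := mul_lt _ _ (mul_nonneg zero_le_two (kl_nonneg (I.ν_mem k l) half_mem)) h1
    linarith
  have shift : ∀ p q x : ℝ, p ∈ Set.Ioo (0 : ℝ) 1 → q ∈ Set.Ioo (0 : ℝ) 1 → d * kl p q < x →
      ∀ᶠ r in nhdsWithin q (Set.Ioi q), d * kl p r < x := fun p q x hp hq h =>
    ((((continuousAt_kl_right hp hq).const_mul d).tendsto).mono_left
      nhdsWithin_le_nhds).eventually_lt_const h
  -- Continuity of `kl p` at `μ 0` and at 1/2 allows `m` and `v` strictly above these limits.
  obtain ⟨m, ⟨hm0, hm1⟩, hmA⟩ := (Filter.Eventually.and (Ioo_mem_nhdsGT (I.μ_mem 0).2)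
    (shift _ _ _ (I.μ_mem k) (I.μ_mem 0) hA)).exists
  obtain ⟨v, hv, hvB⟩ := (Filter.Eventually.and (Ioo_mem_nhdsGT one_half_lt_one)
    (Filter.eventually_all.2 fun l => Filter.eventually_all.2 fun hl : l < k =>
      shift _ _ _ (I.ν_mem k l) half_mem (hB l hl))).exists
  have hmax : ∀ j, I.μ j < m := fun j => (hI.antitone (Fin.zero_le j)).trans_lt hm0
  filter_upwards [I.eventually_mul_log_le_information ⟨(I.μ_mem 0).1.trans hm0, hm1⟩ hv hmax
    hπ ⟨0, hk0⟩ ((div_lt_one hd0).2 hcd)] with T hT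
  have h1 := mul_le_mul_of_nonneg_left hT hd0.le
  rw [← mul_assoc, mul_div_cancel₀ _ hd0.ne'] at h1
  refine h1.trans ?_
  rw [mul_add, Finset.mul_sum, ← mul_assoc]
  simp only [hI.lt_iff_gt, ← mul_assoc d]
  exact add_le_add (mul_le_mul_of_nonneg_right hmA.le (hN T)) (Finset.sum_le_sum fun l hl =>
    mul_le_mul_of_nonneg_right (hvB l (Finset.mem_filter.1 hl).2).le (hM l T))

end Model

end DRMAB

/-! ### Summation over the arms -/

theorem mainTheorem1 {K : ℕ} [NeZero K] (π : DRMAB.Algorithm K) (hπ : π.Consistent)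
    (I : DRMAB.Model K) (hI : StrictAnti I.μ) (α : ℝ) (hα : α ∈ Set.Icc (0 : ℝ) 1) :
    ((∑ k : Fin K with k ≠ 0,
        min (α * I.rewardGap k / DRMAB.kl (I.μ k) (I.μ 0))
          (⨅ l : Set.Iio k,
            (1 - α) * (I.duelGap k + I.duelGap l) / (2 * DRMAB.kl (I.ν k l) (1 / 2))) : ℝ) : EReal)
      ≤ Filter.liminf
          (fun T : ℕ => ((I.expect (π T) T (I.regret α) / Real.log T : ℝ) : EReal))
          Filter.atTop := by
  -- Approximating from below by a real `c` requires only an eventual inequality, so an infinite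
  -- lower limit is covered.
  refine le_of_forall_lt_imp_le_of_dense fun a ha => ?_
  obtain ⟨c, hac, hc⟩ := EReal.lt_iff_exists_real_btwn.1 ha
  refine hac.le.trans (le_liminf_of_le (by isBoundedDefault) ?_)
  rw [EReal.coe_lt_coe_iff] at hc
  set C : Fin K → ℝ := fun k => min (α * I.rewardGap k / DRMAB.kl (I.μ k) (I.μ 0))
    (⨅ l : Set.Iio k, (1 - α) * (I.duelGap k + I.duelGap l) / (2 * DRMAB.kl (I.ν k l) (1 / 2)))
  set n : ℝ := Nat.cast #{k : Fin K | k ≠ 0}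
  have hn : 0 ≤ n := Nat.cast_nonneg _
  obtain ⟨δ, hδ, hδc⟩ : ∃ δ > 0, c ≤ ∑ k with k ≠ 0, (C k - δ) := by
    -- The slack is shared among the `n` suboptimal arms; `n + 1` keeps the denominator nonzero when
    -- `K = 1`.
    refine ⟨(∑ k with k ≠ 0, C k - c) / (n + 1), div_pos (sub_pos.2 hc) (by linarith), ?_⟩
    rw [Finset.sum_sub_distrib, Finset.sum_const, nsmul_eq_mul, ← mul_div_assoc]
    have : n * (∑ k with k ≠ 0, C k - c) / (n + 1) ≤ ∑ k with k ≠ 0, C k - c := by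
      rw [div_le_iff₀ (by linarith), mul_comm n]
      exact mul_le_mul_of_nonneg_left (by linarith) (sub_pos.2 hc).le
    linarith
  have hlog : Tendsto (fun T : ℕ => Real.log (T : ℝ)) atTop atTop :=
    Real.tendsto_log_atTop.comp tendsto_natCast_atTop_atTop
  have harm : ∀ᶠ T : ℕ in atTop, ∀ k : Fin K, k ≠ 0 → (C k - δ) * Real.log T ≤ _ :=
    Filter.eventually_all.2 fun k => Filter.eventually_all.2 fun hk =>
      I.eventually_mul_log_le_arm_regret hI hπ hα hk (sub_lt_self (C k) hδ)
  filter_upwards [harm, hlog.eventually_gt_atTop 0] with T hT hT0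
  rw [EReal.coe_le_coe_iff, le_div_iff₀ hT0]
  calc c * Real.log T ≤ ∑ k with k ≠ 0, (C k - δ) * Real.log T := by
        rw [← Finset.sum_mul]
        exact mul_le_mul_of_nonneg_right hδc hT0.le
    _ ≤ _ := Finset.sum_le_sum fun k hk => hT k (Finset.mem_filter.1 hk).2
    _ = I.expect (π T) T _ := by
        simp only [← DRMAB.Model.expect_const_mul, ← DRMAB.Model.expect_sum,
          ← DRMAB.Model.expect_add]
    _ ≤ _ := I.expect_mono (π T) fun h => I.sum_counts_le_regret hI hα h
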